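/- Let $\mathbb{U}=\{z\in\mathbb{C}:|z|<1\}$. Let $f$ be a complex-valued harmonic function in $\mathbb{U}$, written $f=h+\overline{g}$ with $h,g$ analytic in $\mathbb{U}$, and normalized by $f(0)=h(0)=0$ and $h'(0)=1$, so that $$h(z)=z+\sum_{n=2}^{\infty}a_nz^n,\qquad g(z)=\sum_{n=1}^{\infty}b_nz^n\qquad(z\in\mathbb{U}),$$ and put $a_1=1$, $b_0=0$. Assume that $|b_1|<1$ and that, for some real number $\varphi$, $$\sum_{n=2}^{\infty}\left|na_n-e^{i\varphi}(n-1)a_{n-1}\right|+\sum_{n=1}^{\infty}\left|nb_n-e^{i\varphi}(n-1)b_{n-1}\right|\leq 1 .$$ Then $f$ is harmonic close-to-convex, that is, $f\in\mathcal{C}_{\mathcal{H}}$: $f$ is univalent and sense-preserving (its Jacobian is positive) in $\mathbb{U}$, and $f(\mathbb{U})$ is a close-to-convex domain, i.e. a domain whose complement in $\mathbb{C}$ can be written as a union of closed half-lines that do not intersect each other, except that the origin of one half-line may lie on another half-line. -/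

import Mathlib

open scoped ComplexConjugate ENNReal

/-- The open unit disk of the complex plane. -/
def unitDisk : Set ℂ := Metric.ball 0 1

/-- The `n`-th Taylor coefficient of `F` at the origin. -/
noncomputable def taylorCoeff (F : ℂ → ℂ) (n : ℕ) : ℂ := iteratedDeriv n F 0 / (n.factorial : ℂ)

/-- `f` is a normalized harmonic function in the unit disk, with analytic part `h` and co-analytic
part `g`: `f = h + conj g` in the disk, `f 0 = h 0 = 0` and `h' 0 = 1`. -/
structure IsNormalizedHarmonic (f h g : ℂ → ℂ) : Prop where
  harmonic : InnerProductSpace.HarmonicOnNhd f unitDisk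
  analytic_part : AnalyticOnNhd ℂ h unitDisk
  coanalytic_part : AnalyticOnNhd ℂ g unitDisk
  decomposition : ∀ z ∈ unitDisk, f z = h z + conj (g z)
  map_zero : f 0 = 0
  part_zero : h 0 = 0
  deriv_part_zero : deriv h 0 = 1

/-- The class of normalized harmonic functions in the unit disk. -/
def ClassH : Set (ℂ → ℂ) := {f | ∃ h g : ℂ → ℂ, IsNormalizedHarmonic f h g}

/-- `f` is sense-preserving in `U`: its real Jacobian determinant is positive there. -/
def SensePreservingOn (f : ℂ → ℂ) (U : Set ℂ) : Prop :=
  ∀ z ∈ U, 0 < (fderiv ℝ f z).det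

/-- The class of functions in `ClassH` that are univalent and sense-preserving in the disk. -/
def ClassSH : Set (ℂ → ℂ) :=
  {f | f ∈ ClassH ∧ Set.InjOn f unitDisk ∧ SensePreservingOn f unitDisk}

/-- The closed half-line with origin `w` and direction `v`. -/
def halfLine (w v : ℂ) : Set ℂ := {z | ∃ t : ℝ, 0 ≤ t ∧ z = w + t * v}

/-- `D` is a close-to-convex domain: an open connected nonempty set whose complement is a union of
half-lines (given by pairs of an origin and a unit direction) which do not intersect each other,
except that the origin of one half-line may lie on another half-line. -/
structure IsCloseToConvexDomain (D : Set ℂ) : Prop where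
  isOpen : IsOpen D
  isConnected : IsConnected D
  exists_halfLines : ∃ R : Set (ℂ × ℂ),
    (∀ p ∈ R, ‖p.2‖ = 1) ∧
    Dᶜ = ⋃ p ∈ R, halfLine p.1 p.2 ∧
    ∀ p ∈ R, ∀ q ∈ R, p ≠ q →
      ∀ z ∈ halfLine p.1 p.2 ∩ halfLine q.1 q.2, z = p.1 ∨ z = q.1

/-- The class of harmonic close-to-convex functions: the members of `ClassSH` that map the unit
disk onto a close-to-convex domain. -/
def ClassCH : Set (ℂ → ℂ) := {f | f ∈ ClassSH ∧ IsCloseToConvexDomain (f '' unitDisk)}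

/-! Put `ω = exp(iφ)`. The coefficient sum controls the Taylor series of `(1 - ωz)h'` and `(1 -
ωz)g'`, which gives `|(1 - ωz)h' - 1| + |(1 - ωz)g'| < 1` in the disk (`norm_sub_add_norm_lt_one`).
The substitution `w = -ω⁻¹ log(1 - ωz)`, for which `dz/dw = 1 - ωz`, carries the disk onto a convex
domain `Ω` and turns `f` into `w + P w` with `‖DP‖ < 1`.

As the closure of `Ω` is strictly convex, extending `P` to it and composing with the nearest-point
projection gives a strictly nonexpansive `Q` on the whole plane
(`exists_strictlyNonexpansive_extension`). The map `G = id + Q` is strictly monotone, hence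
injective; it is also open. Since `Q` is constant along outer normal rays of `Ω`, `G` translates
each of them to a half-line, and these fill `range G \ f(𝕌)`. `G` need not be onto, but its range is
convex (`convex_range_id_add`), so what remains is filled by the outer normal rays of the range. -/

section StrictlyNonexpansive

open scoped RealInnerProductSpace

/-! ### Monotone maps `id + P`: injectivity, openness, convexity of the range. -/

/-- `P` strictly decreases distances. -/
def StrictlyNonexpansive {E : Type*} [NormedAddCommGroup E] (P : E → E) : Prop :=
  ∀ x y, x ≠ y → ‖P x - P y‖ < ‖x - y‖

namespace StrictlyNonexpansive

lemma lipschitzWith {E : Type*} [NormedAddCommGroup E] {P : E → E}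
    (hP : StrictlyNonexpansive P) : LipschitzWith 1 P := by
  refine LipschitzWith.of_dist_le_mul fun x y => ?_
  rcases eq_or_ne x y with rfl | h
  · simp
  · simpa [dist_eq_norm] using (hP x y h).le

lemma continuous_id_add {E : Type*} [NormedAddCommGroup E] {P : E → E}
    (hP : StrictlyNonexpansive P) : Continuous fun x => x + P x :=
  continuous_id.add hP.lipschitzWith.continuous

variable {E : Type*} [NormedAddCommGroup E] [InnerProductSpace ℝ E] {P : E → E}

/-- Strict monotonicity of `id + P`: by Cauchy–Schwarz the contribution of `P` is smaller than `‖x -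
y‖ ^ 2`. -/
lemma inner_pos (hP : StrictlyNonexpansive P) {x y : E} (h : x ≠ y) :
    0 < ⟪(x + P x) - (y + P y), x - y⟫ := by
  have h1 : (x + P x) - (y + P y) = (x - y) + (P x - P y) := by abel
  rw [h1, inner_add_left, real_inner_self_eq_norm_sq]
  have h2 := abs_le.1 (abs_real_inner_le_norm (P x - P y) (x - y))
  have h3 : 0 < ‖x - y‖ := norm_pos_iff.2 (sub_ne_zero.2 h)
  nlinarith [hP x y h, h2.1]

lemma inner_nonneg (hP : StrictlyNonexpansive P) (x y : E) :
    0 ≤ ⟪(x + P x) - (y + P y), x - y⟫ := by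
  rcases eq_or_ne x y with rfl | h
  · simp
  · exact (hP.inner_pos h).le

lemma injective_id_add (hP : StrictlyNonexpansive P) :
    Function.Injective fun x => x + P x := by
  intro x y hxy
  by_contra h
  have := hP.inner_pos h
  simp only at hxy
  simp [hxy] at this

/-- The regularized equation is always solvable, by the contraction principle. -/
lemma exists_regularized [CompleteSpace E] (hP : StrictlyNonexpansive P) (x₀ y : E) {s : ℝ}
    (hs : 0 < s) : ∃ w, (w + P w) + s • (w - x₀) = y := by
  have hs1 : 0 < 1 + s := by linarith
  let c : NNReal := ⟨(1 + s)⁻¹, by positivity⟩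
  -- The equation solved for the `w` outside `P`; the factor `(1 + s)⁻¹` makes the right side a
  -- contraction.
  have hc : ContractingWith c fun w => (1 + s)⁻¹ • (y + s • x₀ - P w) := by
    refine ⟨?_, LipschitzWith.of_dist_le_mul fun a b => ?_⟩
    · rw [← NNReal.coe_lt_coe]
      exact inv_lt_one_of_one_lt₀ (by linarith)
    · rw [dist_smul₀, dist_sub_left]
      have := hP.lipschitzWith.dist_le_mul a b
      rw [Real.norm_of_nonneg (by positivity)]
      simp only [NNReal.coe_one, one_mul] at this
      exact mul_le_mul_of_nonneg_left this (by positivity)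
  have hw := hc.fixedPoint_isFixedPt
  set w := ContractingWith.fixedPoint _ hc
  refine ⟨w, ?_⟩
  have h1 : (1 + s)⁻¹ • (y + s • x₀ - P w) = w := hw
  have h2 : y + s • x₀ - P w = (1 + s) • w := by
    rw [inv_smul_eq_iff₀ hs1.ne'] at h1
    exact h1
  rw [smul_sub, eq_comm]
  rw [add_smul, one_smul, sub_eq_iff_eq_add] at h2
  rw [eq_sub_of_add_eq h2]
  abel

variable [ProperSpace E]

/-- If all solutions of the regularized equations stay in a ball, the limit equation is
solvable in that ball. -/
lemma exists_of_regularized_bounded (hP : StrictlyNonexpansive P) (x₀ y : E) (R : ℝ)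
    (h : ∀ s : ℝ, 0 < s → s ≤ 1 → ∀ w, (w + P w) + s • (w - x₀) = y → ‖w - x₀‖ ≤ R) :
    ∃ w ∈ Metric.closedBall x₀ R, w + P w = y := by
  -- The image of the ball is compact, so it is enough to approximate `y`; a regularized solution
  -- misses it by at most `s * R`.
  have hcl : IsClosed ((fun x => x + P x) '' Metric.closedBall x₀ R) :=
    ((isCompact_closedBall x₀ R).image hP.continuous_id_add).isClosed
  have hy : y ∈ closure ((fun x => x + P x) '' Metric.closedBall x₀ R) := by
    refine Metric.mem_closure_iff.2 fun ε hε => ?_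
    have hR : 0 < |R| + 1 := by positivity
    set s := min 1 (ε / (|R| + 1) / 2)
    have hs : 0 < s := lt_min one_pos (by positivity)
    obtain ⟨w, hw⟩ := hP.exists_regularized x₀ y hs
    have hb := h s hs (min_le_left _ _) w hw
    refine ⟨_, ⟨w, by simpa [dist_eq_norm] using hb, rfl⟩, ?_⟩
    rw [← hw, dist_eq_norm, add_sub_cancel_left, norm_smul, Real.norm_of_nonneg hs.le]
    have h2 : s ≤ ε / (|R| + 1) / 2 := min_le_right _ _
    calc s * ‖w - x₀‖ ≤ ε / (|R| + 1) / 2 * (|R| + 1) := by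
          gcongr
          exact hb.trans ((le_abs_self R).trans (by linarith))
      _ = ε / 2 := by field_simp
      _ < ε := by linarith
  rwa [hcl.closure_eq] at hy

/-- On the sphere of radius `r` the monotonicity pairing with `x₀` has a positive lower bound.
Monotonicity propagates it radially outwards, so no regularized solution for a nearby `y` can leave
the ball. -/
lemma exists_ball_subset (hP : StrictlyNonexpansive P) (x₀ : E) {r : ℝ} (hr : 0 < r) :
    ∃ δ > 0, Metric.ball (x₀ + P x₀) δ ⊆ (fun x => x + P x) '' Metric.closedBall x₀ r := by
  have hcont : Continuous fun x => ⟪(x + P x) - (x₀ + P x₀), x - x₀⟫ :=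
    (hP.continuous_id_add.sub continuous_const).inner (continuous_id.sub continuous_const)
  obtain ⟨δ, hδ, hle⟩ := (isCompact_sphere x₀ r).exists_forall_le' hcont.continuousOn (a := 0)
    fun x hx => hP.inner_pos (by
      rintro rfl
      simp at hx
      exact hr.ne hx)
  refine ⟨δ / r, by positivity, fun y hy => ?_⟩
  refine hP.exists_of_regularized_bounded x₀ y r fun s hs _ w hw => ?_
  by_contra! hd
  set d := ‖w - x₀‖
  have hd0 : 0 < d := hr.trans hd
  have hrd : r / d < 1 := (div_lt_one hd0).2 hd
  -- Radial projection of `w` onto the sphere.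
  set w' := x₀ + (r / d) • (w - x₀) with hw'
  have e1 : w' - x₀ = (r / d) • (w - x₀) := by rw [hw']; abel
  have e2 : w - w' = (1 - r / d) • (w - x₀) := by rw [hw', sub_smul, one_smul]; abel
  have hw's : w' ∈ Metric.sphere x₀ r := by
    rw [mem_sphere_iff_norm, e1, norm_smul, Real.norm_of_nonneg (by positivity)]
    exact div_mul_cancel₀ _ hd0.ne'
  have h1 := hle w' hw's
  have h2 := hP.inner_nonneg w w'
  rw [e1, real_inner_smul_right] at h1
  rw [e2, real_inner_smul_right] at h2
  have h3 := nonneg_of_mul_nonneg_right h2 (by linarith)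
  have h4 : ⟪y - (x₀ + P x₀), w - x₀⟫ = ⟪(w + P w) - (w' + P w'), w - x₀⟫
      + ⟪(w' + P w') - (x₀ + P x₀), w - x₀⟫ + s * d ^ 2 := by
    rw [← real_inner_self_eq_norm_sq, ← real_inner_smul_left, ← inner_add_left, ← inner_add_left,
      ← hw]
    congr 1
    abel
  have h5 := (abs_le.1 (abs_real_inner_le_norm (y - (x₀ + P x₀)) (w - x₀))).2
  have h6 : ‖y - (x₀ + P x₀)‖ < δ / r := by simpa [dist_eq_norm] using hy
  have h7 : δ / r * d ≤ ⟪(w' + P w') - (x₀ + P x₀), w - x₀⟫ := by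
    rw [div_mul_eq_mul_div, div_le_iff₀ hr]
    rw [div_mul_eq_mul_div, le_div_iff₀ hd0] at h1
    linarith
  have h8 : ‖y - (x₀ + P x₀)‖ * d < δ / r * d := by gcongr
  have h9 : 0 ≤ s * d ^ 2 := by positivity
  linarith

lemma isOpenMap_id_add (hP : StrictlyNonexpansive P) : IsOpenMap fun x => x + P x := by
  intro U hU
  refine Metric.isOpen_iff.2 ?_
  rintro _ ⟨x, hx, rfl⟩
  obtain ⟨r, hr, hrU⟩ := Metric.isOpen_iff.1 hU x hx
  obtain ⟨δ, hδ, h⟩ := hP.exists_ball_subset x (half_pos hr)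
  exact ⟨δ, hδ, h.trans (Set.image_mono
    ((Metric.closedBall_subset_ball (half_lt_self hr)).trans hrU))⟩

/-- For a convex combination `y` of values `y₁`, `y₂`, the regularized solutions stay bounded.
Monotonicity against preimages of points over `y₁` and `y₂` is averaged with weights `a`, `b`, which
cancels the terms linear in `w`. As `y₁` is interior to the range, it may be shifted towards `w`,
and this leaves a term `-a * (δ / 2) * ‖w‖` that bounds `‖w‖`. -/
lemma convex_range_id_add (hP : StrictlyNonexpansive P) :
    Convex ℝ (Set.range fun x => x + P x) := by
  rintro _ ⟨x₁, rfl⟩ _ ⟨x₂, rfl⟩ a b ha hb hab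
  rcases ha.eq_or_lt with rfl | ha
  · refine ⟨x₂, ?_⟩
    have : b = 1 := by linarith
    simp [this]
  set y₁ := x₁ + P x₁
  set y₂ := x₂ + P x₂
  simp only
  set y := a • y₁ + b • y₂ with hy
  obtain ⟨δ, hδ, hball⟩ := hP.exists_ball_subset x₁ one_pos
  set M := ‖x₁‖ + 1 + ‖x₂‖
  -- `M ^ 2 / 4` is the maximum of `M * t - t ^ 2` and absorbs the terms with `s`; the others bound
  -- the pairings free of `w`.
  set C := M ^ 2 / 4 + a * ((‖y - y₁‖ + δ / 2) * (‖x₁‖ + 1)) + b * (‖y - y₂‖ * ‖x₂‖)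
  have hC : 0 ≤ C := by positivity
  obtain ⟨w, -, hw⟩ := hP.exists_of_regularized_bounded 0 y (C / (a * (δ / 2)))
    fun s hs hs1 w hw => by
      rw [sub_zero] at hw ⊢
      rcases eq_or_ne w 0 with rfl | hw0
      · simp; positivity
      have hn : 0 < ‖w‖ := norm_pos_iff.2 hw0
      rw [le_div_iff₀ (by positivity)]
      set e := (δ / 2 / ‖w‖) • w with he
      have hen : ‖e‖ = δ / 2 := by
        rw [he, norm_smul, Real.norm_of_nonneg (by positivity)]
        field_simp
      obtain ⟨x, hx, hxe⟩ := hball (show y₁ + e ∈ Metric.ball y₁ δ by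
        simp [hen, hδ])
      simp only at hxe
      have hxn : ‖x‖ ≤ ‖x₁‖ + 1 := by
        have : ‖x - x₁‖ ≤ 1 := by simpa [dist_eq_norm] using hx
        have := norm_le_norm_add_norm_sub' x x₁
        linarith
      have hew : ⟪e, w⟫ = δ / 2 * ‖w‖ := by
        rw [he, real_inner_smul_left, real_inner_self_eq_norm_sq]
        field_simp
      have h1 := hP.inner_nonneg w x
      have h2 := hP.inner_nonneg w x₂
      have hG : w + P w = y - s • w := eq_sub_of_add_eq hw
      rw [hxe, hG] at h1
      rw [hG] at h2
      have h3 : ⟪y - s • w - (y₁ + e), w - x⟫ = ⟪y - y₁, w⟫ - δ / 2 * ‖w‖ - s * ‖w‖ ^ 2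
          - ⟪y - y₁ - e, x⟫ + s * ⟪w, x⟫ := by
        rw [← hew, ← real_inner_self_eq_norm_sq w]
        simp only [inner_sub_left, inner_sub_right, inner_add_left, real_inner_smul_left]
        ring
      have h4 : ⟪y - s • w - y₂, w - x₂⟫ = ⟪y - y₂, w⟫ - s * ‖w‖ ^ 2
          - ⟪y - y₂, x₂⟫ + s * ⟪w, x₂⟫ := by
        rw [← real_inner_self_eq_norm_sq w]
        simp only [inner_sub_left, inner_sub_right, real_inner_smul_left]
        ring
      have h5 : a * ⟪y - y₁, w⟫ + b * ⟪y - y₂, w⟫ = 0 := by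
        have hb' : b = 1 - a := by linarith
        rw [← real_inner_smul_left, ← real_inner_smul_left, ← inner_add_left]
        have : a • (y - y₁) + b • (y - y₂) = 0 := by
          rw [hy, hb']
          module
        rw [this, inner_zero_left]
      have h6 : -⟪y - y₁ - e, x⟫ ≤ (‖y - y₁‖ + δ / 2) * (‖x₁‖ + 1) := by
        refine (neg_le_abs _).trans ((abs_real_inner_le_norm _ _).trans ?_)
        have := norm_sub_le (y - y₁) e
        rw [hen] at this
        gcongr
      have h7 : -⟪y - y₂, x₂⟫ ≤ ‖y - y₂‖ * ‖x₂‖ :=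
        (neg_le_abs _).trans (abs_real_inner_le_norm _ _)
      have h8 : ⟪w, x⟫ ≤ ‖w‖ * (‖x₁‖ + 1) :=
        (real_inner_le_norm _ _).trans (by gcongr)
      have h9 : ⟪w, x₂⟫ ≤ ‖w‖ * ‖x₂‖ := real_inner_le_norm _ _
      have ha1 : a ≤ 1 := by linarith
      have hb1 : b ≤ 1 := by linarith
      have h10 : a * ⟪w, x⟫ + b * ⟪w, x₂⟫ ≤ ‖w‖ * M := by
        have i1 : a * ⟪w, x⟫ ≤ a * (‖w‖ * (‖x₁‖ + 1)) := by gcongr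
        have i2 : b * ⟪w, x₂⟫ ≤ b * (‖w‖ * ‖x₂‖) := by gcongr
        have i3 : a * (‖w‖ * (‖x₁‖ + 1)) ≤ 1 * (‖w‖ * (‖x₁‖ + 1)) := by gcongr
        have i4 : b * (‖w‖ * ‖x₂‖) ≤ 1 * (‖w‖ * ‖x₂‖) := by gcongr
        have i5 : ‖w‖ * M = ‖w‖ * (‖x₁‖ + 1) + ‖w‖ * ‖x₂‖ := by simp only [M]; ring
        linarith
      have h11 : s * (‖w‖ * M) - s * ‖w‖ ^ 2 ≤ M ^ 2 / 4 := by
        have j1 : s * (‖w‖ * M) - s * ‖w‖ ^ 2 ≤ s * (M ^ 2 / 4) := by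
          nlinarith [mul_nonneg hs.le (sq_nonneg (‖w‖ - M / 2))]
        have j2 : s * (M ^ 2 / 4) ≤ 1 * (M ^ 2 / 4) := by gcongr
        linarith
      have h12 := mul_nonneg ha.le h1
      have h13 := mul_nonneg hb h2
      rw [h3] at h12
      rw [h4] at h13
      have h14 := mul_le_mul_of_nonneg_left h6 ha.le
      have h15 := mul_le_mul_of_nonneg_left h7 hb
      have h16 := mul_le_mul_of_nonneg_left h10 hs.le
      have h17 : a * (s * ‖w‖ ^ 2) + b * (s * ‖w‖ ^ 2) = s * ‖w‖ ^ 2 := by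
        rw [← add_mul, hab, one_mul]
      simp only [C]
      linarith
  exact ⟨w, hw⟩

end StrictlyNonexpansive

/-! ### Nearest-point projection, outer normals and the nonexpansive extension. -/

variable {E : Type*} [NormedAddCommGroup E] [InnerProductSpace ℝ E]

/-- A nearest-point map onto a closed convex set, described by its variational inequality. -/
lemma exists_nearestPoint [CompleteSpace E] {K : Set E} (hne : K.Nonempty) (hcl : IsClosed K)
    (hK : Convex ℝ K) : ∃ p : E → E, ∀ w, p w ∈ K ∧ ∀ y ∈ K, ⟪w - p w, y - p w⟫ ≤ 0 := by
  have : ∀ w, ∃ q, q ∈ K ∧ ∀ y ∈ K, ⟪w - q, y - q⟫ ≤ 0 := fun w => by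
    obtain ⟨q, hq, h⟩ := exists_norm_eq_iInf_of_complete_convex hne hcl.isComplete hK w
    exact ⟨q, hq, (norm_eq_iInf_iff_real_inner_le_zero hK hq).1 h⟩
  choose p hp using this
  exact ⟨p, hp⟩

lemma norm_sub_le_of_variational {x y p q : E} (h₁ : ⟪x - p, q - p⟫ ≤ 0)
    (h₂ : ⟪y - q, p - q⟫ ≤ 0) : ‖p - q‖ ≤ ‖x - y‖ := by
  have h3 : ⟪x - y, p - q⟫ = ‖p - q‖ ^ 2 - ⟪x - p, q - p⟫ - ⟪y - q, p - q⟫ := by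
    rw [← real_inner_self_eq_norm_sq]
    simp only [inner_sub_left, inner_sub_right]
    ring
  have h4 := real_inner_le_norm (x - y) (p - q)
  by_contra! h
  nlinarith [norm_nonneg (x - y)]

lemma eq_of_variational {x p q : E} (h₁ : ⟪x - p, q - p⟫ ≤ 0)
    (h₂ : ⟪x - q, p - q⟫ ≤ 0) : p = q := by
  have := norm_sub_le_of_variational h₁ h₂
  rw [sub_self, norm_zero] at this
  exact sub_eq_zero.1 (norm_eq_zero.1 (le_antisymm this (norm_nonneg _)))

/-- The pairs of a boundary point of `C` and a unit outer normal vector there. -/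
def outerNormals (C : Set E) : Set (E × E) :=
  {p | p.1 ∈ closure C ∧ p.1 ∉ C ∧ ‖p.2‖ = 1 ∧ ∀ y ∈ closure C, ⟪p.2, y - p.1⟫ ≤ 0}

lemma outerNormals_variational {C : Set E} {p : E × E} (hp : p ∈ outerNormals C) {t : ℝ}
    (ht : 0 ≤ t) : ∀ y ∈ closure C, ⟪p.1 + t • p.2 - p.1, y - p.1⟫ ≤ 0 := fun y hy => by
  rw [add_sub_cancel_left, real_inner_smul_left]
  exact mul_nonpos_of_nonneg_of_nonpos ht (hp.2.2.2 y hy)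

lemma add_smul_notMem_of_mem_outerNormals {C : Set E} {p : E × E} (hp : p ∈ outerNormals C)
    {t : ℝ} (ht : 0 ≤ t) : p.1 + t • p.2 ∉ C := by
  intro h
  rcases ht.eq_or_lt with rfl | ht
  · exact hp.2.1 (by simpa using h)
  · have := hp.2.2.2 _ (subset_closure h)
    rw [add_sub_cancel_left, real_inner_smul_right, real_inner_self_eq_norm_sq, hp.2.2.1] at this
    linarith

/-- A common point has both origins as its nearest point in the closure, so the origins agree; then
so do the directions unless the point is the origin itself. -/
lemma eq_of_add_smul_eq_of_mem_outerNormals {C : Set E} {p q : E × E} (hp : p ∈ outerNormals C)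
    (hq : q ∈ outerNormals C) {t u : ℝ} (ht : 0 ≤ t) (hu : 0 ≤ u)
    (h : p.1 + t • p.2 = q.1 + u • q.2) : p = q ∨ t = 0 := by
  have h1 : p.1 = q.1 := eq_of_variational (x := p.1 + t • p.2)
    (outerNormals_variational hp ht _ hq.1) (by
      rw [h]; exact outerNormals_variational hq hu _ hp.1)
  rw [h1, add_right_inj] at h
  have h2 := congrArg norm h
  rw [norm_smul, norm_smul, hp.2.2.1, hq.2.2.1, Real.norm_of_nonneg ht, Real.norm_of_nonneg hu,
    mul_one, mul_one] at h2
  by_cases h0 : t = 0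
  · exact Or.inr h0
  · left
    rw [← h2] at h
    exact Prod.ext h1 (smul_right_injective _ h0 h)

/-- At a boundary point Hahn–Banach supplies the normal; off the closure the normal points from the
nearest point to `w`. -/
lemma exists_outerNormals_of_notMem [CompleteSpace E] {C : Set E} (hne : C.Nonempty)
    (ho : IsOpen C) (hC : Convex ℝ C) {w : E} (hw : w ∉ C) :
    ∃ p ∈ outerNormals C, ∃ t : ℝ, 0 ≤ t ∧ w = p.1 + t • p.2 := by
  by_cases hwc : w ∈ closure C
  · obtain ⟨l, hl⟩ := geometric_hahn_banach_open_point hC ho hw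
    set v := (InnerProductSpace.toDual ℝ E).symm l
    have hv : ∀ x, ⟪v, x⟫ = l x := fun x => InnerProductSpace.toDual_symm_apply
    have hle : ∀ y ∈ closure C, l y ≤ l w :=
      closure_minimal (fun y hy => (hl y hy).le) (isClosed_le l.continuous continuous_const)
    have hv0 : v ≠ 0 := by
      intro h0
      obtain ⟨a, ha⟩ := hne
      have := hl a ha
      rw [← hv, ← hv, h0, inner_zero_left, inner_zero_left] at this
      exact this.false
    refine ⟨(w, ‖v‖⁻¹ • v), ⟨hwc, hw, ?_, fun y hy => ?_⟩, 0, le_rfl, by simp⟩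
    · simp [norm_smul, hv0]
    · simp only
      rw [real_inner_smul_left, hv, map_sub]
      exact mul_nonpos_of_nonneg_of_nonpos (by positivity) (by linarith [hle y hy])
  · obtain ⟨q, hq⟩ := exists_nearestPoint hne.closure isClosed_closure hC.closure
    obtain ⟨h1, h2⟩ := hq w
    have hwq : w - q w ≠ 0 := fun h => hwc (by rw [sub_eq_zero.1 h]; exact h1)
    have hn : 0 < ‖w - q w‖ := norm_pos_iff.2 hwq
    refine ⟨(q w, ‖w - q w‖⁻¹ • (w - q w)), ⟨h1, fun h => ?_, ?_, fun y hy => ?_⟩,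
      ‖w - q w‖, hn.le, ?_⟩
    -- If the nearest point were in the open set, a small step towards `w` would violate the
    -- variational inequality.
    · obtain ⟨ε, hε, hb⟩ := Metric.isOpen_iff.1 ho _ h
      have hmem : q w + (ε / 2 / ‖w - q w‖) • (w - q w) ∈ C := hb (by
        rw [mem_ball_iff_norm, add_sub_cancel_left, norm_smul, Real.norm_of_nonneg (by positivity),
          div_mul_cancel₀ _ hn.ne']
        linarith)
      have := h2 _ (subset_closure hmem)
      rw [add_sub_cancel_left, real_inner_smul_right, real_inner_self_eq_norm_sq] at this
      have : 0 < ε / 2 / ‖w - q w‖ * ‖w - q w‖ ^ 2 := by positivity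
      linarith
    · simp [norm_smul, hn.ne']
    · simp only
      rw [real_inner_smul_left]
      exact mul_nonpos_of_nonneg_of_nonpos (by positivity) (h2 y hy)
    · simp only
      rw [smul_inv_smul₀ hn.ne']
      abel

/-- A 1-Lipschitz function on a convex set that has derivative of norm less than one at a point of
each chord strictly decreases distances on the closure. -/
lemma norm_sub_lt_of_midpoint {Q : E → E} {K : Set E} (hK : Convex ℝ K)
    (hQ : LipschitzOnWith 1 Q K) {x y : E} (hx : x ∈ K) (hy : y ∈ K) (hxy : x ≠ y)
    {D : E →L[ℝ] E} (hD : HasFDerivAt Q D (midpoint ℝ x y)) (hD1 : ‖D‖ < 1) :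
    ‖Q x - Q y‖ < ‖x - y‖ := by
  set m := midpoint ℝ x y
  have hyx : 0 < ‖y - x‖ := norm_pos_iff.2 (sub_ne_zero.2 hxy.symm)
  -- A short piece of the chord just past the midpoint is strictly contracted; the two remaining
  -- pieces are not expanded.
  have hder := hD.isLittleO.def (c := (1 - ‖D‖) / 2) (by linarith)
  have hlim : Filter.Tendsto (fun ε : ℝ => m + ε • (y - x)) (nhdsWithin 0 (Set.Ioi 0))
      (nhds m) := by
    have : Continuous fun ε : ℝ => m + ε • (y - x) := by fun_prop
    have h := this.tendsto 0
    simp only [zero_smul, add_zero] at h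
    exact h.mono_left nhdsWithin_le_nhds
  have hev := (hlim.eventually hder).and (Ioo_mem_nhdsGT (show (0 : ℝ) < 1 / 2 by norm_num))
  obtain ⟨ε, h1, h2, h3⟩ := hev.exists
  set z := m + ε • (y - x) with hz
  have hm : m = x + (1 / 2 : ℝ) • (y - x) := by
    simp only [m, midpoint_eq_smul_add]
    norm_num
    module
  have hmK : m ∈ K := by
    rw [hm]
    exact hK.add_smul_sub_mem hx hy ⟨by norm_num, by norm_num⟩
  have hzx : z = x + (1 / 2 + ε) • (y - x) := by
    rw [hz, hm]; module
  have hzK : z ∈ K := by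
    rw [hzx]
    exact hK.add_smul_sub_mem hx hy ⟨by linarith, by linarith⟩
  have hlt : ‖Q z - Q m‖ < ε * ‖y - x‖ := by
    have e : z - m = ε • (y - x) := by rw [hz]; abel
    have hn : ‖z - m‖ = ε * ‖y - x‖ := by rw [e, norm_smul, Real.norm_of_nonneg h2.le]
    have hp : 0 < ‖z - m‖ := by rw [hn]; positivity
    rw [← hn]
    calc ‖Q z - Q m‖ = ‖(Q z - Q m - D (z - m)) + D (z - m)‖ := by congr 1; abel
      _ ≤ (1 - ‖D‖) / 2 * ‖z - m‖ + ‖D‖ * ‖z - m‖ :=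
        (norm_add_le _ _).trans (add_le_add h1 (D.le_opNorm _))
      _ < ‖z - m‖ := by nlinarith
  have d1 : ‖Q x - Q m‖ ≤ 1 / 2 * ‖y - x‖ := by
    have := hQ.dist_le_mul x hx m hmK
    simp only [dist_eq_norm, NNReal.coe_one, one_mul] at this
    refine this.trans_eq ?_
    rw [hm, sub_add_cancel_left, norm_neg, norm_smul]
    norm_num
  have d2 : ‖Q z - Q y‖ ≤ (1 / 2 - ε) * ‖y - x‖ := by
    have := hQ.dist_le_mul z hzK y hy
    simp only [dist_eq_norm, NNReal.coe_one, one_mul] at this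
    refine this.trans_eq ?_
    have : z - y = -((1 / 2 - ε) • (y - x)) := by rw [hzx]; module
    rw [this, norm_neg, norm_smul, Real.norm_of_nonneg (by linarith)]
  have : Q x - Q y = (Q x - Q m) + (Q m - Q z) + (Q z - Q y) := by abel
  have := norm_add₃_le (a := Q x - Q m) (b := Q m - Q z) (c := Q z - Q y)
  rw [norm_sub_rev (Q m)] at this
  calc ‖Q x - Q y‖ = ‖(Q x - Q m) + (Q m - Q z) + (Q z - Q y)‖ := by congr 1
    _ < ‖y - x‖ := by linarith
    _ = ‖x - y‖ := norm_sub_rev _ _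

/-- A 1-Lipschitz function on an open convex set, whose derivative has norm less than one there,
extends to a strictly nonexpansive function that is constant along outer normals, provided the
closure is strictly convex. -/
lemma exists_strictlyNonexpansive_extension [CompleteSpace E] {C : Set E} (hne : C.Nonempty)
    (ho : IsOpen C) (hC : Convex ℝ C)
    (hmid : ∀ x ∈ closure C, ∀ y ∈ closure C, x ≠ y → midpoint ℝ x y ∈ C) {P : E → E}
    {D : E → E →L[ℝ] E} (hD : ∀ x ∈ C, HasFDerivAt P (D x) x) (hD1 : ∀ x ∈ C, ‖D x‖ < 1) :
    ∃ Q : E → E, StrictlyNonexpansive Q ∧ Set.EqOn Q P C ∧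
      ∀ p ∈ outerNormals C, ∀ t : ℝ, 0 ≤ t → Q (p.1 + t • p.2) = Q p.1 := by
  have hP : LipschitzOnWith 1 P C := hC.lipschitzOnWith_of_nnnorm_hasFDerivWithin_le
    (fun x hx => (hD x hx).hasFDerivWithinAt) fun x hx => by
      rw [← NNReal.coe_le_coe]; exact (hD1 x hx).le
  have htend : ∀ x ∈ closure C, ∃ y, Filter.Tendsto P (nhdsWithin x C) (nhds y) := fun x hx => by
    have : (nhdsWithin x C).NeBot := mem_closure_iff_nhdsWithin_neBot.1 hx
    have hc : Cauchy (nhdsWithin x C) := cauchy_nhds.mono nhdsWithin_le_nhds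
    exact cauchy_map_iff_exists_tendsto.1
      (hc.map_of_le hP.uniformContinuousOn (Filter.le_principal_iff.2 self_mem_nhdsWithin))
  set P' := extendFrom C P
  have hP'c : ContinuousOn P' (closure C) := continuousOn_extendFrom subset_rfl htend
  have hP'e : Set.EqOn P' P C := fun x hx =>
    extendFrom_eq (subset_closure hx) (hD x hx).continuousAt.continuousWithinAt
  have hP'l : LipschitzOnWith 1 P' (closure C) := by
    refine LipschitzOnWith.closure hP'c ?_
    intro x hx y hy
    rw [hP'e hx, hP'e hy]
    exact hP hx hy
  obtain ⟨q, hq⟩ := exists_nearestPoint hne.closure isClosed_closure hC.closure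
  have hqe : ∀ w ∈ closure C, q w = w := fun w hw =>
    eq_of_variational (x := w) ((hq w).2 w hw) (by simp)
  -- Strictness comes from `P'` when the projections differ, and is trivial when they coincide.
  refine ⟨P' ∘ q, fun x y hxy => ?_, fun x hx => ?_, fun p hp t ht => ?_⟩
  · have hle := norm_sub_le_of_variational ((hq x).2 _ (hq y).1) ((hq y).2 _ (hq x).1)
    rcases eq_or_ne (q x) (q y) with h | h
    · simpa [h, sub_eq_zero] using hxy
    · have hm := hmid _ (hq x).1 _ (hq y).1 h
      refine lt_of_lt_of_le (norm_sub_lt_of_midpoint hC.closure hP'l (hq x).1 (hq y).1 h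
        ((hD _ hm).congr_of_eventuallyEq ?_) (hD1 _ hm)) hle
      exact hP'e.eventuallyEq_of_mem (ho.mem_nhds hm)
  · rw [Function.comp_apply, hqe x (subset_closure hx), hP'e hx]
  · rw [Function.comp_apply, Function.comp_apply, hqe _ hp.1]
    congr 1
    exact eq_of_variational (x := p.1 + t • p.2) ((hq _).2 _ hp.1)
      (outerNormals_variational hp ht _ (hq _).1)

end StrictlyNonexpansive

/-! ### Half-lines filling the complement of the image. -/

lemma mem_halfLine {w v z : ℂ} : z ∈ halfLine w v ↔ ∃ t : ℝ, 0 ≤ t ∧ z = w + t • v := by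
  simp [halfLine]

lemma isCloseToConvexDomain_image_id_add {C : Set ℂ} (hne : C.Nonempty) (ho : IsOpen C)
    (hC : Convex ℝ C) {Q : ℂ → ℂ} (hQ : StrictlyNonexpansive Q)
    (hray : ∀ p ∈ outerNormals C, ∀ t : ℝ, 0 ≤ t → Q (p.1 + t • p.2) = Q p.1) :
    IsCloseToConvexDomain ((fun x => x + Q x) '' C) := by
  set G : ℂ → ℂ := fun x => x + Q x with hG
  have hGray : ∀ p ∈ outerNormals C, ∀ t : ℝ, 0 ≤ t → G (p.1 + t • p.2) = G p.1 + t • p.2 :=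
    fun p hp t ht => by simp only [hG, hray p hp t ht]; abel
  have hinj : Function.Injective G := hQ.injective_id_add
  have hopen : IsOpen (Set.range G) := hQ.isOpenMap_id_add.isOpen_range
  have hconv : Convex ℝ (Set.range G) := hQ.convex_range_id_add
  have hnorm_in : ∀ p ∈ outerNormals C, ∀ z ∈ halfLine (G p.1) p.2, z ∈ Set.range G := by
    intro p hp z hz
    obtain ⟨t, ht, rfl⟩ := mem_halfLine.1 hz
    exact ⟨_, hGray p hp t ht⟩
  have hnorm_out : ∀ p ∈ outerNormals (Set.range G), ∀ z ∈ halfLine p.1 p.2,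
      z ∉ Set.range G := by
    intro p hp z hz
    obtain ⟨t, ht, rfl⟩ := mem_halfLine.1 hz
    exact add_smul_notMem_of_mem_outerNormals hp ht
  refine ⟨hQ.isOpenMap_id_add C ho,
    ⟨hne.image _, hC.isPreconnected.image _ hQ.continuous_id_add.continuousOn⟩,
    (fun p : ℂ × ℂ => (G p.1, p.2)) '' outerNormals C ∪ outerNormals (Set.range G), ?_, ?_, ?_⟩
  · rintro _ (⟨p, hp, rfl⟩ | hp)
    · exact hp.2.2.1
    · exact hp.2.2.1
  · ext z
    simp only [Set.mem_compl_iff, Set.mem_iUnion, exists_prop]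
    constructor
    · intro hz
      by_cases hzr : z ∈ Set.range G
      · obtain ⟨w, rfl⟩ := hzr
        have hw : w ∉ C := fun h => hz ⟨w, h, rfl⟩
        obtain ⟨p, hp, t, ht, rfl⟩ := exists_outerNormals_of_notMem hne ho hC hw
        exact ⟨_, Or.inl ⟨p, hp, rfl⟩, mem_halfLine.2 ⟨t, ht, hGray p hp t ht⟩⟩
      · obtain ⟨p, hp, t, ht, h⟩ :=
          exists_outerNormals_of_notMem (Set.range_nonempty G) hopen hconv hzr
        exact ⟨p, Or.inr hp, mem_halfLine.2 ⟨t, ht, h⟩⟩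
    · rintro ⟨_, ⟨p, hp, rfl⟩ | hp, hz⟩ ⟨w, hw, rfl⟩
      · obtain ⟨t, ht, h⟩ := mem_halfLine.1 hz
        rw [← hGray p hp t ht] at h
        rw [hinj h] at hw
        exact add_smul_notMem_of_mem_outerNormals hp ht hw
      · exact hnorm_out _ hp _ hz ⟨w, rfl⟩
  -- Two rays of the first family are pulled back by injectivity of `G`; rays of different families
  -- are separated by the range of `G`.
  · rintro _ (⟨p, hp, rfl⟩ | hp) _ (⟨q, hq, rfl⟩ | hq) hpq z ⟨hz₁, hz₂⟩
    · obtain ⟨t, ht, rfl⟩ := mem_halfLine.1 hz₁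
      obtain ⟨u, hu, h⟩ := mem_halfLine.1 hz₂
      simp only at h
      rw [← hGray p hp t ht, ← hGray q hq u hu] at h
      rcases eq_of_add_smul_eq_of_mem_outerNormals hp hq ht hu (hinj h) with rfl | rfl
      · exact absurd rfl hpq
      · left; simp
    · exact absurd (hnorm_in p hp z hz₁) (hnorm_out _ hq z hz₂)
    · exact absurd (hnorm_in q hq z hz₂) (hnorm_out _ hp z hz₁)
    · obtain ⟨t, ht, rfl⟩ := mem_halfLine.1 hz₁
      obtain ⟨u, hu, h⟩ := mem_halfLine.1 hz₂
      rcases eq_of_add_smul_eq_of_mem_outerNormals hp hq ht hu h with rfl | rfl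
      · exact absurd rfl hpq
      · left; simp

/-! ### The logarithmic image of the disk and its strict convexity. -/

/-- The image of the unit disk under `-log (1 - z)`. -/
def negLogDomain : Set ℂ :=
  {w | |w.im| < Real.pi / 2 ∧ Real.exp (-w.re) < 2 * Real.cos w.im}

lemma isOpen_negLogDomain : IsOpen negLogDomain := by
  have h₁ : IsOpen {w : ℂ | |w.im| < Real.pi / 2} := isOpen_lt (by fun_prop) (by fun_prop)
  have h₂ : IsOpen {w : ℂ | Real.exp (-w.re) < 2 * Real.cos w.im} :=
    isOpen_lt (by fun_prop) (by fun_prop)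
  exact h₁.inter h₂

lemma zero_mem_negLogDomain : 0 ∈ negLogDomain := by
  simp [negLogDomain, Real.pi_pos]

lemma closure_negLogDomain_subset : closure negLogDomain ⊆
    {w | |w.im| ≤ Real.pi / 2 ∧ Real.exp (-w.re) ≤ 2 * Real.cos w.im} := by
  have h₁ : IsClosed {w : ℂ | |w.im| ≤ Real.pi / 2} := isClosed_le (by fun_prop) (by fun_prop)
  have h₂ : IsClosed {w : ℂ | Real.exp (-w.re) ≤ 2 * Real.cos w.im} :=
    isClosed_le (by fun_prop) (by fun_prop)
  exact closure_minimal (fun _ hw => ⟨hw.1.le, hw.2.le⟩) (h₁.inter h₂)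

/-- Strictness comes from `exp` when the imaginary parts agree, and from `cos` otherwise. -/
lemma strictConvex_closure_negLogDomain {x y : ℂ} (hx : x ∈ closure negLogDomain)
    (hy : y ∈ closure negLogDomain) (hxy : x ≠ y) {a b : ℝ} (ha : 0 < a) (hb : 0 < b)
    (hab : a + b = 1) : a • x + b • y ∈ negLogDomain := by
  obtain ⟨hx1, hx2⟩ := closure_negLogDomain_subset hx
  obtain ⟨hy1, hy2⟩ := closure_negLogDomain_subset hy
  rw [abs_le] at hx1 hy1
  have hxI : x.im ∈ Set.Icc (-(Real.pi / 2)) (Real.pi / 2) := hx1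
  have hyI : y.im ∈ Set.Icc (-(Real.pi / 2)) (Real.pi / 2) := hy1
  have hlt : Real.exp (-(a * x.re + b * y.re)) < 2 * Real.cos (a * x.im + b * y.im) := by
    have e : -(a * x.re + b * y.re) = a • -x.re + b • -y.re := by simp; ring
    rw [e]
    by_cases him : x.im = y.im
    · have hre : -x.re ≠ -y.re := fun h => hxy (Complex.ext (neg_injective h) him)
      have h := strictConvexOn_exp.2 (Set.mem_univ _) (Set.mem_univ _) hre ha hb hab
      refine h.trans_le ?_
      rw [← him, ← add_mul, hab, one_mul]
      rw [← him] at hy2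
      have h1 := mul_le_mul_of_nonneg_left hx2 ha.le
      have h2 := mul_le_mul_of_nonneg_left hy2 hb.le
      simp only [smul_eq_mul]
      have : 2 * Real.cos x.im = a * (2 * Real.cos x.im) + b * (2 * Real.cos x.im) := by
        rw [← add_mul, hab, one_mul]
      linarith
    · have h := strictConcaveOn_cos_Icc.2 hxI hyI him ha hb hab
      refine (convexOn_exp.2 (Set.mem_univ _) (Set.mem_univ _) ha.le hb.le hab).trans_lt ?_
      have h1 := mul_le_mul_of_nonneg_left hx2 ha.le
      have h2 := mul_le_mul_of_nonneg_left hy2 hb.le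
      simp only [smul_eq_mul] at h ⊢
      linarith
  have hI : a * x.im + b * y.im ∈ Set.Icc (-(Real.pi / 2)) (Real.pi / 2) := by
    have := convex_Icc (-(Real.pi / 2)) (Real.pi / 2) hxI hyI ha.le hb.le hab
    simpa using this
  have hcos : 0 < Real.cos (a * x.im + b * y.im) := by
    linarith [Real.exp_pos (-(a * x.re + b * y.re))]
  refine ⟨?_, by simpa using hlt⟩
  have him : (a • x + b • y).im = a * x.im + b * y.im := by simp
  rw [him]
  -- The endpoints `±π / 2` are excluded because the cosine is positive.
  refine lt_of_le_of_ne (abs_le.2 hI) fun h => ?_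
  rw [← Real.cos_abs, h, Real.cos_pi_div_two] at hcos
  exact hcos.false

lemma convex_negLogDomain : Convex ℝ negLogDomain := by
  refine convex_iff_forall_pos.2 fun x hx y hy a b ha hb hab => ?_
  rcases eq_or_ne x y with rfl | h
  · rwa [← add_smul, hab, one_smul]
  · exact strictConvex_closure_negLogDomain (subset_closure hx) (subset_closure hy) h ha hb hab

lemma norm_one_sub_exp_neg_lt_one {w : ℂ} (hw : w ∈ negLogDomain) :
    ‖1 - Complex.exp (-w)‖ < 1 := by
  rw [← sq_lt_one_iff₀ (norm_nonneg _), ← Complex.normSq_eq_norm_sq, Complex.normSq_apply]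
  simp only [Complex.sub_re, Complex.sub_im, Complex.exp_re, Complex.exp_im, Complex.neg_re,
    Complex.neg_im, Complex.one_re, Complex.one_im, Real.cos_neg, Real.sin_neg]
  have h := mul_lt_mul_of_pos_left hw.2 (Real.exp_pos (-w.re))
  nlinarith [Real.sin_sq_add_cos_sq w.im]

lemma neg_log_one_sub_mem_negLogDomain {z : ℂ} (hz : ‖z‖ < 1) :
    -Complex.log (1 - z) ∈ negLogDomain := by
  have hre : 0 < (1 - z).re := by
    have := (Complex.re_le_norm z).trans_lt hz
    simp; linarith
  have h0 : 1 - z ≠ 0 := fun h => by simp [h] at hre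
  have hn : 0 < ‖1 - z‖ := norm_pos_iff.2 h0
  refine ⟨?_, ?_⟩
  · rw [Complex.neg_im, abs_neg, Complex.log_im, Complex.abs_arg_lt_pi_div_two_iff]
    exact Or.inl hre
  · rw [Complex.neg_im, Real.cos_neg, Complex.log_im, Complex.cos_arg h0, Complex.neg_re, neg_neg,
      Complex.log_re, Real.exp_log hn, ← mul_div_assoc, lt_div_iff₀ hn, ← sq,
      ← Complex.normSq_eq_norm_sq, Complex.normSq_apply]
    have : z.re * z.re + z.im * z.im < 1 := by
      rw [← Complex.normSq_apply, Complex.normSq_eq_norm_sq]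
      exact (sq_lt_one_iff₀ (norm_nonneg _)).2 hz
    simp
    nlinarith

/-! ### Real differentials of harmonic functions. -/

/-- The real-linear map `v ↦ α v + conj (β v)`. -/
noncomputable def harmonicDifferential (α β : ℂ) : ℂ →L[ℝ] ℂ :=
  (ContinuousLinearMap.toSpanSingleton ℂ α).restrictScalars ℝ +
    (Complex.conjCLE : ℂ →L[ℝ] ℂ) ∘L (ContinuousLinearMap.toSpanSingleton ℂ β).restrictScalars ℝ

lemma harmonicDifferential_apply (α β v : ℂ) :
    harmonicDifferential α β v = α * v + conj (β * v) := by
  simp [harmonicDifferential, mul_comm]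

lemma norm_harmonicDifferential_le (α β : ℂ) : ‖harmonicDifferential α β‖ ≤ ‖α‖ + ‖β‖ := by
  refine ContinuousLinearMap.opNorm_le_bound _ (by positivity) fun v => ?_
  rw [harmonicDifferential_apply]
  refine (norm_add_le _ _).trans ?_
  rw [RCLike.norm_conj, norm_mul, norm_mul, add_mul]

lemma det_harmonicDifferential (α β : ℂ) :
    (harmonicDifferential α β).det = ‖α‖ ^ 2 - ‖β‖ ^ 2 := by
  rw [ContinuousLinearMap.det, ← LinearMap.det_toMatrix Complex.basisOneI, Matrix.det_fin_two,
    ← Complex.normSq_eq_norm_sq, ← Complex.normSq_eq_norm_sq, Complex.normSq_apply,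
    Complex.normSq_apply]
  simp [LinearMap.toMatrix_apply, harmonicDifferential_apply]
  ring

lemma hasFDerivAt_add_conj {h g : ℂ → ℂ} {α β z : ℂ} (hh : HasDerivAt h α z)
    (hg : HasDerivAt g β z) :
    HasFDerivAt (fun w => h w + conj (g w)) (harmonicDifferential α β) z := by
  have h1 := hh.hasFDerivAt.restrictScalars ℝ
  have h2 := Complex.conjCLE.hasFDerivAt.comp z (hg.hasFDerivAt.restrictScalars ℝ)
  exact h1.add h2

/-! ### From the coefficient condition to the derivative bound. -/

lemma tsum_subtype_le_eq (k : ℕ) (u : ℕ → ℝ≥0∞) :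
    ∑' n : {n : ℕ // k ≤ n}, u n = ∑' n : ℕ, u (n + k) := by
  let e : ℕ ≃ {n : ℕ // k ≤ n} :=
    { toFun := fun n => ⟨n + k, Nat.le_add_left k n⟩
      invFun := fun n => n - k
      left_inv := fun n => Nat.add_sub_cancel n k
      right_inv := fun n => Subtype.ext (Nat.sub_add_cancel n.2) }
  exact (e.tsum_eq fun n : {n : ℕ // k ≤ n} => u n).symm

lemma hasSum_one_sub_mul_deriv {F : ℂ → ℂ} (hF : AnalyticOnNhd ℂ F unitDisk) (ω : ℂ) {z : ℂ}
    (hz : z ∈ unitDisk) :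
    HasSum (fun n : ℕ => (((n : ℂ) + 1) * taylorCoeff F (n + 1) - ω * n * taylorCoeff F n) * z ^ n)
      ((1 - ω * z) * deriv F z) := by
  have h1 : HasSum (fun n : ℕ => ((n : ℂ) + 1) * taylorCoeff F (n + 1) * z ^ n) (deriv F z) := by
    have h := Complex.hasSum_taylorSeries_on_ball hF.deriv.differentiableOn hz
    refine h.congr_fun ?_
    intro n
    have : ((n : ℂ) + 1) ≠ 0 := Nat.cast_add_one_ne_zero n
    have : (n.factorial : ℂ) ≠ 0 := Nat.cast_ne_zero.2 n.factorial_ne_zero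
    rw [taylorCoeff, ← iteratedDeriv_succ', Nat.factorial_succ]
    push_cast
    simp only [smul_eq_mul, sub_zero]
    field_simp
  have h2 : HasSum (fun n : ℕ => ω * n * taylorCoeff F n * z ^ n) (ω * z * deriv F z) := by
    rw [← hasSum_nat_add_iff' 1]
    simp only [Finset.range_one, Finset.sum_singleton, Nat.cast_zero, mul_zero, zero_mul, sub_zero]
    refine (h1.mul_left (ω * z)).congr_fun ?_
    intro n
    push_cast
    ring
  have h3 := h1.sub h2
  rw [sub_mul, one_mul]
  simpa only [sub_mul] using h3

lemma summable_norm_of_tsum_enorm_le_one {c : ℕ → ℂ} (h : ∑' n, ‖c n‖ₑ ≤ 1) :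
    Summable fun n => ‖c n‖ := by
  have h' : ∑' n, (‖c n‖₊ : ℝ≥0∞) ≠ ⊤ := ne_top_of_le_ne_top ENNReal.one_ne_top h
  exact NNReal.summable_coe.2 (ENNReal.tsum_coe_ne_top_iff_summable.1 h')

lemma tsum_norm_add_le_one {c d : ℕ → ℂ} (h : ∑' n, ‖c n‖ₑ + ∑' n, ‖d n‖ₑ ≤ 1) :
    ∑' n, ‖c n‖ + ∑' n, ‖d n‖ ≤ 1 := by
  have hc := summable_norm_of_tsum_enorm_le_one (le_self_add.trans h)
  have hd := summable_norm_of_tsum_enorm_le_one (le_add_self.trans h)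
  have e : ∀ {u : ℕ → ℂ}, (Summable fun n => ‖u n‖) → ∑' n, ‖u n‖ₑ = ENNReal.ofReal (∑' n, ‖u n‖) :=
    fun hu => by
      rw [ENNReal.ofReal_tsum_of_nonneg (fun _ => norm_nonneg _) hu]
      simp only [ofReal_norm]
  rw [e hc, e hd, ← ENNReal.ofReal_add (tsum_nonneg fun _ => norm_nonneg _)
    (tsum_nonneg fun _ => norm_nonneg _)] at h
  exact ENNReal.ofReal_le_one.1 h

/-- All terms beyond the constant ones `1` and `b₁` carry a factor `z`, so the left side is at most
`|b₁| + |z| (1 - |b₁|)`, which is below 1 because `|b₁| < 1`. -/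
lemma norm_sub_add_norm_lt_one {h g : ℂ → ℂ} (hh : AnalyticOnNhd ℂ h unitDisk)
    (hg : AnalyticOnNhd ℂ g unitDisk) (hh1 : deriv h 0 = 1) (hb : ‖taylorCoeff g 1‖ < 1) (ω : ℂ)
    (hsum : ∑' n : {n : ℕ // 2 ≤ n},
          ‖(n : ℂ) * taylorCoeff h n - ω * ((n : ℂ) - 1) * taylorCoeff h ((n : ℕ) - 1)‖ₑ
        + ∑' n : {n : ℕ // 1 ≤ n},
          ‖(n : ℂ) * taylorCoeff g n - ω * ((n : ℂ) - 1) * taylorCoeff g ((n : ℕ) - 1)‖ₑ ≤ 1)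
    {z : ℂ} (hz : z ∈ unitDisk) :
    ‖(1 - ω * z) * deriv h z - 1‖ + ‖(1 - ω * z) * deriv g z‖ < 1 := by
  set c : (ℂ → ℂ) → ℕ → ℂ := fun F n =>
    ((n : ℂ) + 1) * taylorCoeff F (n + 1) - ω * n * taylorCoeff F n with hc
  rw [tsum_subtype_le_eq 2 fun n =>
      ‖(n : ℂ) * taylorCoeff h n - ω * ((n : ℂ) - 1) * taylorCoeff h (n - 1)‖ₑ,
    tsum_subtype_le_eq 1 fun n =>
      ‖(n : ℂ) * taylorCoeff g n - ω * ((n : ℂ) - 1) * taylorCoeff g (n - 1)‖ₑ] at hsum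
  have hsum' : ∑' n, ‖c h (n + 1)‖ₑ + ∑' n, ‖c g n‖ₑ ≤ 1 := by
    convert hsum using 5 with n n
    · simp only [hc, Nat.add_succ_sub_one]
      push_cast
      ring_nf
    · simp only [hc, Nat.add_succ_sub_one, add_zero]
      push_cast
      ring_nf
  have hle := tsum_norm_add_le_one hsum'
  have hch := summable_norm_of_tsum_enorm_le_one (le_self_add.trans hsum')
  have hcg := summable_norm_of_tsum_enorm_le_one (le_add_self.trans hsum')
  have h1 := (hasSum_nat_add_iff' 1).2 (hasSum_one_sub_mul_deriv hh ω hz)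
  have h2 := (hasSum_nat_add_iff' 1).2 (hasSum_one_sub_mul_deriv hg ω hz)
  have hh1' : taylorCoeff h 1 = 1 := by simp [taylorCoeff, hh1]
  simp only [Finset.range_one, Finset.sum_singleton, Nat.cast_zero, zero_add, mul_zero, zero_mul,
    sub_zero, pow_zero, mul_one, one_mul, hh1'] at h1 h2
  have hz1 : ‖z‖ < 1 := by simpa [unitDisk] using hz
  have hbound : ∀ u : ℂ, ∀ n : ℕ, ‖u * z ^ (n + 1)‖ ≤ ‖u‖ * ‖z‖ := fun u n => by
    rw [norm_mul, norm_pow]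
    gcongr
    exact pow_le_of_le_one (norm_nonneg _) hz1.le (Nat.succ_ne_zero n)
  have h3 := h1.norm_le_of_bounded (hch.hasSum.mul_right ‖z‖) fun n => by
    simpa only [hc] using hbound (c h (n + 1)) n
  have h4 := h2.norm_le_of_bounded (((summable_nat_add_iff 1).2 hcg).hasSum.mul_right ‖z‖)
    fun n => by simpa only [hc] using hbound (c g (n + 1)) n
  have h5 := hcg.tsum_eq_zero_add
  have h6 : c g 0 = taylorCoeff g 1 := by simp [hc]
  rw [h6] at h5
  rw [h5] at hle
  have h7 : ‖(1 - ω * z) * deriv g z‖ ≤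
      ‖(1 - ω * z) * deriv g z - taylorCoeff g 1‖ + ‖taylorCoeff g 1‖ := by
    simpa using norm_add_le ((1 - ω * z) * deriv g z - taylorCoeff g 1) (taylorCoeff g 1)
  nlinarith [norm_nonneg z]

/-! ### The change of variable and the conclusion. -/

theorem theorem3 (f h g : ℂ → ℂ) (hf : IsNormalizedHarmonic f h g)
    (hb : ‖taylorCoeff g 1‖ < 1) (φ : ℝ)
    (hsum :
      (∑' n : {n : ℕ // 2 ≤ n},
          ‖(n : ℂ) * taylorCoeff h n
            - Complex.exp (Complex.I * φ) * ((n : ℂ) - 1) * taylorCoeff h ((n : ℕ) - 1)‖ₑ)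
        + (∑' n : {n : ℕ // 1 ≤ n},
          ‖(n : ℂ) * taylorCoeff g n
            - Complex.exp (Complex.I * φ) * ((n : ℂ) - 1) * taylorCoeff g ((n : ℕ) - 1)‖ₑ)
        ≤ 1) :
    f ∈ ClassCH := by
  set ω := Complex.exp (Complex.I * φ) with hω
  have hω1 : ‖ω‖ = 1 := by rw [hω, mul_comm]; exact Complex.norm_exp_ofReal_mul_I φ
  have hω0 : ω ≠ 0 := Complex.exp_ne_zero _
  have hbound := fun {z : ℂ} (hz : z ∈ unitDisk) =>
    norm_sub_add_norm_lt_one hf.analytic_part hf.coanalytic_part hf.deriv_part_zero hb ω hsum hz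
  have hUo : IsOpen unitDisk := Metric.isOpen_ball
  have hfev : ∀ z ∈ unitDisk, f =ᶠ[nhds z] fun w => h w + conj (g w) := fun z hz =>
    Filter.eventuallyEq_of_mem (hUo.mem_nhds hz) hf.decomposition
  have hsense : SensePreservingOn f unitDisk := fun z hz => by
    have hd := (hasFDerivAt_add_conj (hf.analytic_part z hz).differentiableAt.hasDerivAt
      (hf.coanalytic_part z hz).differentiableAt.hasDerivAt).congr_of_eventuallyEq (hfev z hz)
    rw [hd.fderiv, det_harmonicDifferential]
    have h1 := hbound hz
    have h2 : 1 - ‖(1 - ω * z) * deriv h z - 1‖ ≤ ‖(1 - ω * z) * deriv h z‖ := by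
      have := norm_sub_norm_le (1 : ℂ) (1 - (1 - ω * z) * deriv h z)
      rw [norm_one, norm_sub_rev, sub_sub_cancel] at this
      exact this
    have h3 : ‖1 - ω * z‖ * ‖deriv g z‖ < ‖1 - ω * z‖ * ‖deriv h z‖ := by
      rw [← norm_mul, ← norm_mul]
      linarith
    have h4 := lt_of_mul_lt_mul_left h3 (norm_nonneg _)
    exact sub_pos.2 (pow_lt_pow_left₀ h4 (norm_nonneg _) two_ne_zero)
  set Ω : Set ℂ := (fun w => ω * w) ⁻¹' negLogDomain
  -- Inverse of the logarithmic substitution; it solves `ζ' = 1 - ωζ`, so the chain rule produces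
  -- exactly the factors in `hbound`.
  set ζ : ℂ → ℂ := fun w => ω⁻¹ * (1 - Complex.exp (-(ω * w))) with hζ
  have hζU : ∀ w ∈ Ω, ζ w ∈ unitDisk := fun w hw => by
    rw [unitDisk, mem_ball_zero_iff, hζ, norm_mul, norm_inv, hω1, inv_one, one_mul]
    exact norm_one_sub_exp_neg_lt_one hw
  have hζsurj : ∀ z ∈ unitDisk, ∃ w ∈ Ω, ζ w = z := fun z hz => by
    have hz1 : ‖ω * z‖ < 1 := by
      rw [norm_mul, hω1, one_mul]
      simpa [unitDisk] using hz
    have h0 : 1 - ω * z ≠ 0 := fun h => by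
      rw [← sub_eq_zero.1 h, norm_one] at hz1
      exact hz1.false
    refine ⟨ω⁻¹ * -Complex.log (1 - ω * z), ?_, ?_⟩
    · rw [Set.mem_preimage, mul_inv_cancel_left₀ hω0]
      exact neg_log_one_sub_mem_negLogDomain hz1
    · simp only [hζ]
      rw [mul_inv_cancel_left₀ hω0, neg_neg, Complex.exp_log h0, sub_sub_cancel,
        inv_mul_cancel_left₀ hω0]
  have hΩo : IsOpen Ω := isOpen_negLogDomain.preimage (by fun_prop)
  have hΩne : Ω.Nonempty := ⟨0, by simpa [Ω] using zero_mem_negLogDomain⟩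
  have hΩc : Convex ℝ Ω := convex_negLogDomain.linear_preimage (LinearMap.mulLeft ℝ ω)
  have hmid : ∀ x ∈ closure Ω, ∀ y ∈ closure Ω, x ≠ y → midpoint ℝ x y ∈ Ω := by
    intro x hx y hy hxy
    have hcl : ∀ {w}, w ∈ closure Ω → ω * w ∈ closure negLogDomain := fun hw =>
      map_mem_closure (continuous_const_mul ω) hw fun _ h => h
    have := strictConvex_closure_negLogDomain (hcl hx) (hcl hy)
      (fun h => hxy (mul_left_cancel₀ hω0 h)) (a := 1 / 2) (b := 1 / 2) (by norm_num)
      (by norm_num) (by norm_num)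
    rw [Set.mem_preimage]
    convert this using 1
    rw [midpoint_eq_smul_add]
    simp only [Complex.real_smul, invOf_eq_inv]
    push_cast
    ring
  have hD : ∀ w ∈ Ω, HasFDerivAt (fun w => f (ζ w) - w)
      (harmonicDifferential ((1 - ω * ζ w) * deriv h (ζ w) - 1)
        ((1 - ω * ζ w) * deriv g (ζ w))) w := fun w hw => by
    have hζd : HasDerivAt ζ (1 - ω * ζ w) w := by
      have h1 := (((hasDerivAt_id w).const_mul ω).neg.cexp.const_sub 1).const_mul ω⁻¹
      refine h1.congr_deriv ?_
      simp only [hζ, id, Pi.neg_apply]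
      field_simp
      ring
    have hhd := ((hf.analytic_part _ (hζU w hw)).differentiableAt.hasDerivAt.comp w hζd).sub
      (hasDerivAt_id w)
    have hgd := (hf.coanalytic_part _ (hζU w hw)).differentiableAt.hasDerivAt.comp w hζd
    rw [mul_comm] at hhd hgd
    refine (hasFDerivAt_add_conj hhd hgd).congr_of_eventuallyEq ?_
    filter_upwards [hζd.continuousAt.eventually (hfev _ (hζU w hw))] with x hx
    simp [hx]
    ring
  obtain ⟨Q, hQ, hQe, hray⟩ := exists_strictlyNonexpansive_extension hΩne hΩo hΩc hmid hD
    fun w hw => (norm_harmonicDifferential_le _ _).trans_lt (hbound (hζU w hw))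
  have hfQ : ∀ w ∈ Ω, w + Q w = f (ζ w) := fun w hw => by
    rw [hQe hw]
    ring
  have himage : f '' unitDisk = (fun w => w + Q w) '' Ω := by
    ext y
    constructor
    · rintro ⟨z, hz, rfl⟩
      obtain ⟨w, hw, rfl⟩ := hζsurj z hz
      exact ⟨w, hw, hfQ w hw⟩
    · rintro ⟨w, hw, rfl⟩
      exact ⟨ζ w, hζU w hw, (hfQ w hw).symm⟩
  refine ⟨⟨⟨h, g, hf⟩, fun z₁ hz₁ z₂ hz₂ heq => ?_, hsense⟩, ?_⟩
  · obtain ⟨w₁, hw₁, rfl⟩ := hζsurj z₁ hz₁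
    obtain ⟨w₂, hw₂, rfl⟩ := hζsurj z₂ hz₂
    rw [← hfQ w₁ hw₁, ← hfQ w₂ hw₂] at heq
    rw [hQ.injective_id_add heq]
  · rw [himage]
    exact isCloseToConvexDomain_image_id_add hΩne hΩo hΩc hQ hray
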